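/- \textbf{Theorem (Representation of orbifold groupoids).} Let $G$ be an orbifold groupoid over $G_0$, i.e. a proper étale Lie groupoid: the arrows $G$ and the objects $G_0$ are smooth manifolds, $G_0$ is Hausdorff and second countable, all structure maps are smooth, the source and target maps $s,t:G\to G_0$ are local diffeomorphisms, $G$ is Hausdorff, and $(s,t):G\to G_0\times G_0$ is a proper map. Then there exist a continuous family $E=(\{E_x\}_{x\in G_0},\Gamma)$ of finite-dimensional Hilbert spaces over $G_0$ and a faithful unitary representation of $G$ on $E$. Here a \emph{continuous family of Hilbert spaces} over a locally compact Hausdorff space $B$ consists of complex Hilbert spaces $E_x$ $(x\in B)$ and a linear subspace $\Gamma\subset\prod_{x\in B}E_x$ such that (1) for all $x\in B$ and $v\in E_x$ there is $\sigma\in\Gamma$ with $\sigma(x)=v$; (2) for all $\sigma_1,\sigma_2\in\Gamma$ the function $x\mapsto\langle \sigma_1(x),\sigma_2(x)\rangle$ is continuous on $B$; (3) if $w\in\prod_{x\in B}E_x$ is such that for all $x\in B$ and $\varepsilon>0$ there are a neighbourhood $U$ of $x$ and $\sigma\in\Gamma$ with $\|\sigma(x')-w(x')\|<\varepsilon$ for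 all $x'\in U$, then $w\in\Gamma$. The total space $\coprod_{x\in B}E_x$, with projection $p$ to $B$, carries the topology generated by the tubular sets $\{v : p(v)\in V,\ \|\sigma(p(v))-v\|<\varepsilon\}$, for $V\subset B$ open, $\sigma\in\Gamma$ and $\varepsilon>0$. A \emph{representation} of $G$ on $E$ is a left action of $G$ on the total space along $p$, continuous as a map $\{(g,v)\in G\times\coprod_x E_x : s(g)=p(v)\}\to\coprod_x E_x$, in which each arrow $g$ from $x$ to $y$ acts as a linear isomorphism $E_x\to E_y$. It is \emph{unitary} if each arrow acts as a unitary map, and \emph{faithful} if for each $x\in G_0$ the isotropy group $G_x$ of arrows from $x$ to $x$ acts faithfully on $E_x$. -/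

import Mathlib

open scoped Manifold ContDiff Topology

universe u v w

/-! ### Groupoids with a space of arrows -/

/-- The set of all arrows of a groupoid `G` with set of objects `G₀`. -/
structure ArrowSpace (G₀ : Type u) [CategoryTheory.Groupoid.{v} G₀] : Type (max u v) where
  /-- the source of the arrow -/
  src : G₀
  /-- the target of the arrow -/
  tgt : G₀
  /-- the arrow itself -/
  hom : src ⟶ tgt

namespace ArrowSpace

variable {G₀ : Type u} [CategoryTheory.Groupoid.{v} G₀]

/-- The unit map `x ↦ 1ₓ`. -/
def unit (x : G₀) : ArrowSpace G₀ := ⟨x, x, CategoryTheory.CategoryStruct.id x⟩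

/-- The inversion `g ↦ g⁻¹`. -/
def inv (g : ArrowSpace G₀) : ArrowSpace G₀ := ⟨g.tgt, g.src, CategoryTheory.Groupoid.inv g.hom⟩

end ArrowSpace

/-- The set of composable pairs `(g, f)` of arrows `f : x ⟶ y`, `g : y ⟶ z`, that is, the fibre
product of the arrow space with itself over the objects (along source and target). -/
structure ComposablePair (G₀ : Type u) [CategoryTheory.Groupoid.{v} G₀] : Type (max u v) where
  /-- source of the first arrow -/
  x : G₀
  /-- common middle object -/
  y : G₀
  /-- target of the second arrow -/
  z : G₀
  /-- the arrow applied second -/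
  g : y ⟶ z
  /-- the arrow applied first -/
  f : x ⟶ y

namespace ComposablePair

variable {G₀ : Type u} [CategoryTheory.Groupoid.{v} G₀]

/-- A composable pair as an element of the product of two copies of the arrow space. -/
def toProd (p : ComposablePair G₀) : ArrowSpace G₀ × ArrowSpace G₀ :=
  (⟨p.y, p.z, p.g⟩, ⟨p.x, p.y, p.f⟩)

/-- The multiplication `(g, f) ↦ g f`. -/
def mul (p : ComposablePair G₀) : ArrowSpace G₀ :=
  ⟨p.x, p.z, CategoryTheory.CategoryStruct.comp p.f p.g⟩

/-- The fibre product carries the subspace topology. -/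
instance [TopologicalSpace (ArrowSpace G₀)] : TopologicalSpace (ComposablePair G₀) :=
  TopologicalSpace.induced toProd inferInstance

end ComposablePair

/-- A topological groupoid over a Hausdorff space of objects: all structure maps are continuous,
source, target and multiplication are open, and the unit map is an embedding. -/
structure IsTopologicalGroupoid (G₀ : Type u) [CategoryTheory.Groupoid.{v} G₀]
    [TopologicalSpace G₀] [TopologicalSpace (ArrowSpace G₀)] : Prop where
  t2_obj : T2Space G₀
  continuous_src : Continuous (ArrowSpace.src : ArrowSpace G₀ → G₀)
  continuous_tgt : Continuous (ArrowSpace.tgt : ArrowSpace G₀ → G₀)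
  continuous_inv : Continuous (ArrowSpace.inv : ArrowSpace G₀ → ArrowSpace G₀)
  continuous_mul : Continuous (ComposablePair.mul : ComposablePair G₀ → ArrowSpace G₀)
  isOpenMap_src : IsOpenMap (ArrowSpace.src : ArrowSpace G₀ → G₀)
  isOpenMap_tgt : IsOpenMap (ArrowSpace.tgt : ArrowSpace G₀ → G₀)
  isOpenMap_mul : IsOpenMap (ComposablePair.mul : ComposablePair G₀ → ArrowSpace G₀)
  isEmbedding_unit : Topology.IsEmbedding (ArrowSpace.unit : G₀ → ArrowSpace G₀)

/-- A Lie groupoid: a topological groupoid whose spaces of objects and of arrows are smooth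
manifolds (of dimensions `n` and `m`), the objects being Hausdorff and second countable, such that
source and target are smooth submersions with Hausdorff fibres and all structure maps are smooth.
Smoothness of the multiplication on the fibre product, which is an embedded submanifold of the
product of two copies of the arrow space, is expressed by local smooth extensions. -/
structure IsLieGroupoid (n m : ℕ) (G₀ : Type u) [CategoryTheory.Groupoid.{v} G₀]
    [TopologicalSpace G₀] [ChartedSpace (EuclideanSpace ℝ (Fin n)) G₀]
    [TopologicalSpace (ArrowSpace G₀)] [ChartedSpace (EuclideanSpace ℝ (Fin m)) (ArrowSpace G₀)] :
    Prop extends IsTopologicalGroupoid G₀ where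
  isManifold_obj : IsManifold (𝓡 n) ∞ G₀
  isManifold_arrow : IsManifold (𝓡 m) ∞ (ArrowSpace G₀)
  secondCountable_obj : SecondCountableTopology G₀
  t2_src_fibre : ∀ x : G₀, T2Space {g : ArrowSpace G₀ // g.src = x}
  t2_tgt_fibre : ∀ x : G₀, T2Space {g : ArrowSpace G₀ // g.tgt = x}
  submersion_src : Manifold.IsSubmersion (𝓡 m) (𝓡 n) ∞ (ArrowSpace.src : ArrowSpace G₀ → G₀)
  submersion_tgt : Manifold.IsSubmersion (𝓡 m) (𝓡 n) ∞ (ArrowSpace.tgt : ArrowSpace G₀ → G₀)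
  smooth_unit : ContMDiff (𝓡 n) (𝓡 m) ∞ (ArrowSpace.unit : G₀ → ArrowSpace G₀)
  smooth_inv : ContMDiff (𝓡 m) (𝓡 m) ∞ (ArrowSpace.inv : ArrowSpace G₀ → ArrowSpace G₀)
  smooth_mul : ∀ p : ComposablePair G₀, ∃ U ∈ 𝓝 p.toProd,
    ∃ F : ArrowSpace G₀ × ArrowSpace G₀ → ArrowSpace G₀,
      ContMDiffOn ((𝓡 m).prod (𝓡 m)) (𝓡 m) ∞ F U ∧
        ∀ q : ComposablePair G₀, q.toProd ∈ U → F q.toProd = q.mul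

/-- An orbifold groupoid: a proper étale Lie groupoid. Proper means that the arrow space is
Hausdorff and `(s, t)` is a proper map; étale means that `s` and `t` are local diffeomorphisms. -/
structure IsOrbifoldGroupoid (n m : ℕ) (G₀ : Type u) [CategoryTheory.Groupoid.{v} G₀]
    [TopologicalSpace G₀] [ChartedSpace (EuclideanSpace ℝ (Fin n)) G₀]
    [TopologicalSpace (ArrowSpace G₀)] [ChartedSpace (EuclideanSpace ℝ (Fin m)) (ArrowSpace G₀)] :
    Prop extends IsLieGroupoid n m G₀ where
  t2_arrow : T2Space (ArrowSpace G₀)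
  proper : IsProperMap fun g : ArrowSpace G₀ => (g.src, g.tgt)
  etale_src : IsLocalDiffeomorph (𝓡 m) (𝓡 n) ∞ (ArrowSpace.src : ArrowSpace G₀ → G₀)
  etale_tgt : IsLocalDiffeomorph (𝓡 m) (𝓡 n) ∞ (ArrowSpace.tgt : ArrowSpace G₀ → G₀)

/-! ### Continuous families of Hilbert spaces -/

/-- A continuous family of (complex) Hilbert spaces over a locally compact Hausdorff space `B`. -/
structure HilbertFamily (B : Type u) [TopologicalSpace B] [LocallyCompactSpace B] [T2Space B] :
    Type (max u (w + 1)) where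
  /-- the Hilbert space over a point -/
  fibre : B → Type w
  [normed : ∀ x, NormedAddCommGroup (fibre x)]
  [innerProduct : ∀ x, InnerProductSpace ℂ (fibre x)]
  [complete : ∀ x, CompleteSpace (fibre x)]
  /-- the space `Γ` of sections -/
  sections : Submodule ℂ (∀ x, fibre x)
  exists_section : ∀ (x : B) (e : fibre x), ∃ s ∈ sections, s x = e
  continuous_inner : ∀ s₁ ∈ sections, ∀ s₂ ∈ sections,
    Continuous fun x => inner ℂ (s₁ x) (s₂ x)
  mem_of_locally_approx : ∀ e : (∀ x, fibre x),
    (∀ (x : B) (ε : ℝ), 0 < ε → ∃ U ∈ 𝓝 x, ∃ s ∈ sections, ∀ y ∈ U, ‖s y - e y‖ < ε) →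
      e ∈ sections

namespace HilbertFamily

attribute [instance] HilbertFamily.normed HilbertFamily.innerProduct HilbertFamily.complete

variable {B : Type u} [TopologicalSpace B] [LocallyCompactSpace B] [T2Space B]

/-- A family of finite dimensional Hilbert spaces. -/
def IsFiniteDimensional (E : HilbertFamily.{u, w} B) : Prop :=
  ∀ x, FiniteDimensional ℂ (E.fibre x)

/-- The total space, the disjoint union of the fibres. -/
structure Total (E : HilbertFamily.{u, w} B) : Type (max u w) where
  /-- the projection to the base -/
  base : B
  /-- the vector in the fibre -/
  vec : E.fibre base

/-- The tubular set of radius `ε` around the section `s` over `V`. -/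
def tube (E : HilbertFamily.{u, w} B) (V : Set B) (s : ∀ x, E.fibre x) (ε : ℝ) : Set E.Total :=
  {e | e.base ∈ V ∧ ‖s e.base - e.vec‖ < ε}

/-- The topology of the total space, generated by the tubular sets around sections in `Γ` over
open sets. -/
instance (E : HilbertFamily.{u, w} B) : TopologicalSpace E.Total :=
  TopologicalSpace.generateFrom
    {W | ∃ V : Set B, IsOpen V ∧ ∃ s ∈ E.sections, ∃ ε : ℝ, 0 < ε ∧ W = E.tube V s ε}

end HilbertFamily

/-! ### Representations of groupoids -/

/-- The fibre product of the arrow space of `G` (along the source) and the total space of a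
family of Hilbert spaces over the space of objects: pairs of an arrow `g` and a vector in the
fibre over the source of `g`. -/
structure ActionDomain {G₀ : Type u} [CategoryTheory.Groupoid.{v} G₀] [TopologicalSpace G₀]
    [LocallyCompactSpace G₀] [T2Space G₀] (E : HilbertFamily.{u, w} G₀) :
    Type (max u v w) where
  /-- the arrow -/
  arrow : ArrowSpace G₀
  /-- a vector in the fibre over the source of the arrow -/
  vec : E.fibre arrow.src

namespace ActionDomain

variable {G₀ : Type u} [CategoryTheory.Groupoid.{v} G₀] [TopologicalSpace G₀]
  [LocallyCompactSpace G₀] [T2Space G₀] {E : HilbertFamily.{u, w} G₀}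

/-- The inclusion of the fibre product into the product. -/
def toProd (p : ActionDomain E) : ArrowSpace G₀ × E.Total := (p.arrow, ⟨p.arrow.src, p.vec⟩)

/-- The fibre product carries the subspace topology. -/
instance [TopologicalSpace (ArrowSpace G₀)] : TopologicalSpace (ActionDomain E) :=
  TopologicalSpace.induced toProd inferInstance

end ActionDomain

/-- A continuous representation of a groupoid on a continuous family `E` of Hilbert spaces over
its space of objects: a continuous left action on the total space of `E` along the projection, in
which each arrow `g : x ⟶ y` acts by a linear isomorphism from the fibre over `x` to the fibre
over `y`. -/
structure GroupoidRep {G₀ : Type u} [CategoryTheory.Groupoid.{v} G₀] [TopologicalSpace G₀]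
    [LocallyCompactSpace G₀] [T2Space G₀] [TopologicalSpace (ArrowSpace G₀)]
    (E : HilbertFamily.{u, w} G₀) : Type (max u v w) where
  /-- the action of an arrow -/
  act : ∀ {x y : G₀}, (x ⟶ y) → (E.fibre x ≃ₗ[ℂ] E.fibre y)
  act_id : ∀ (x : G₀) (e : E.fibre x), act (CategoryTheory.CategoryStruct.id x) e = e
  act_comp : ∀ {x y z : G₀} (f : x ⟶ y) (g : y ⟶ z) (e : E.fibre x),
    act (CategoryTheory.CategoryStruct.comp f g) e = act g (act f e)
  continuous_act : Continuous fun p : ActionDomain E =>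
    (⟨p.arrow.tgt, act p.arrow.hom p.vec⟩ : E.Total)

namespace GroupoidRep

variable {G₀ : Type u} [CategoryTheory.Groupoid.{v} G₀] [TopologicalSpace G₀]
  [LocallyCompactSpace G₀] [T2Space G₀] [TopologicalSpace (ArrowSpace G₀)]
  {E : HilbertFamily.{u, w} G₀}

/-- Each arrow acts as a unitary map between the fibres. -/
def IsUnitary (ρ : GroupoidRep E) : Prop :=
  ∀ {x y : G₀} (g : x ⟶ y) (e e' : E.fibre x), inner ℂ (ρ.act g e) (ρ.act g e') = inner ℂ e e'

/-- For each object `x`, the isotropy group at `x` acts faithfully on the fibre over `x`. -/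
def IsFaithful (ρ : GroupoidRep E) : Prop :=
  ∀ x : G₀, Function.Injective fun g : x ⟶ x => ρ.act g

end GroupoidRep

/-!
Choose an open set `W` of objects that meets every orbit and whose points with orbit near a given
one stay in a compact set; it exists because the orbit space is paracompact. As the groupoid is
proper and étale, only finitely many arrows into an object `x` start in `W`, and over a small
neighbourhood of `x` they form part of finitely many sheets of the target map. Let `E_x` be the
Hilbert space of functions on this finite set of arrows: the direct image of the trivial line bundle
along the target map, whose sections are the continuous functions on the arrow space that vanish on
the arrows starting outside `W`. An arrow `g : x ⟶ y` acts by transport along the bijection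
`k ↦ k ≫ g`, so unitarily, and faithfully because `k ≫ g` determines `g`. The action is continuous
since, near a given arrow, sections can be translated along a local bisection.
-/

open CategoryTheory Set Filter Function

section RelativelyCompactOver

variable {X Y M : Type*} [TopologicalSpace X] [TopologicalSpace Y] {t : X → Y} {A : Set X}

/-- The set `A` is relatively compact over the base of `t : X → Y`: every point of `Y` has a
neighbourhood over which `A` stays in one compact set. For closed `A`, continuous `t` and locally
compact Hausdorff `Y` this says that `t` is proper on `A`; it is applied to open sets `A`. -/
def IsRelativelyCompactOver (t : X → Y) (A : Set X) : Prop :=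
  ∀ y, ∃ K : Set X, IsCompact K ∧ ∀ᶠ y' in 𝓝 y, A ∩ t ⁻¹' {y'} ⊆ K

theorem IsRelativelyCompactOver.mono {A' : Set X} (hA : IsRelativelyCompactOver t A)
    (h : A' ⊆ A) : IsRelativelyCompactOver t A' := fun y => by
  obtain ⟨K, hK, hAK⟩ := hA y
  exact ⟨K, hK, hAK.mono fun y' hy' => (inter_subset_inter_left _ h).trans hy'⟩

theorem exists_isOpen_isRelativelyCompactOver [WeaklyLocallyCompactSpace X] [ParacompactSpace Y]
    (ht : IsOpenQuotientMap t) : ∃ W, IsOpen W ∧ t '' W = univ ∧ IsRelativelyCompactOver t W := by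
  choose K hK hxK using fun x : X => exists_compact_mem_nhds x
  have hcover : ⋃ x, t '' interior (K x) = univ := eq_univ_of_forall fun y => by
    obtain ⟨x, rfl⟩ := ht.surjective y
    exact mem_iUnion.2 ⟨x, mem_image_of_mem t (mem_interior_iff_mem_nhds.2 (hxK x))⟩
  obtain ⟨v, hv, hv_cover, hv_fin, hvK⟩ :=
    precise_refinement _ (fun x => ht.isOpenMap _ (isOpen_interior (s := K x))) hcover
  refine ⟨⋃ x, interior (K x) ∩ t ⁻¹' v x,
    isOpen_iUnion fun x => isOpen_interior.inter ((hv x).preimage ht.continuous), ?_, fun y => ?_⟩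
  · simp only [image_iUnion, image_inter_preimage, inter_eq_right.2 (hvK _), hv_cover]
  · obtain ⟨N, hN, hN_fin⟩ := hv_fin y
    refine ⟨_, hN_fin.isCompact_biUnion fun x _ => hK x, ?_⟩
    filter_upwards [hN] with y' hy'
    rintro x ⟨hx, rfl⟩
    obtain ⟨a, haK, hav⟩ := mem_iUnion.1 hx
    exact mem_biUnion (show a ∈ {a | (v a ∩ N).Nonempty} from ⟨t x, hav, hy'⟩)
      (interior_subset haK)

theorem finite_inter_fibre_of_isCompact [T1Space Y] (ht : IsLocalHomeomorph t) {K : Set X}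
    (hK : IsCompact K) (y : Y) : (K ∩ t ⁻¹' {y}).Finite := by
  have himage : (t '' (K ∩ t ⁻¹' {y})).Subsingleton :=
    subsingleton_singleton.anti (image_subset_iff.2 inter_subset_right)
  exact (hK.inter_right (isClosed_singleton.preimage ht.continuous)).finite
    (ht.isLocalHomeomorphOn.isDiscrete_of_image himage.isDiscrete)

theorem IsRelativelyCompactOver.finite_inter_fibre [T1Space Y] (hA : IsRelativelyCompactOver t A)
    (ht : IsLocalHomeomorph t) (y : Y) : (A ∩ t ⁻¹' {y}).Finite := by
  obtain ⟨K, hK, hAK⟩ := hA y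
  exact (finite_inter_fibre_of_isCompact ht hK y).subset
    (subset_inter hAK.self_of_nhds inter_subset_right)

theorem exists_local_sections_of_isCompact [T2Space X] [T2Space Y] (ht : IsLocalHomeomorph t)
    {K : Set X} (hK : IsCompact K) (y₀ : Y) :
    ∃ σ : ↥(K ∩ t ⁻¹' {y₀}) → Y → X, (∀ i, ContinuousAt (σ i) y₀) ∧
      ∀ᶠ y in 𝓝 y₀, Injective (σ · y) ∧ (∀ i, t (σ i y) = y) ∧
        K ∩ t ⁻¹' {y} ⊆ range (σ · y) := by
  have := (finite_inter_fibre_of_isCompact ht hK y₀).to_subtype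
  have htc := ht.continuous
  choose e he hte using ht
  have hval (i : ↥(K ∩ t ⁻¹' {y₀})) : e i i = y₀ := (congrFun (hte i) i).symm.trans i.2.2
  have hy₀ (i : ↥(K ∩ t ⁻¹' {y₀})) : y₀ ∈ (e i).target := by
    simpa only [hval] using (e i).map_source (he i)
  have hσ (i : ↥(K ∩ t ⁻¹' {y₀})) : (e i).symm y₀ = i := by
    simpa only [hval] using (e i).left_inv (he i)
  refine ⟨fun i => (e i).symm, fun i => (e i).continuousAt_symm (hy₀ i), ?_⟩
  have hinj : ∀ᶠ y in 𝓝 y₀, Injective fun i : ↥(K ∩ t ⁻¹' {y₀}) => (e i).symm y := by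
    have hne : ∀ᶠ y in 𝓝 y₀, ∀ i j : ↥(K ∩ t ⁻¹' {y₀}), i ≠ j → (e i).symm y ≠ (e j).symm y :=
      eventually_all.2 fun i => eventually_all.2 fun j => eventually_imp_distrib_left.2 fun hij =>
        (((e i).continuousAt_symm (hy₀ i)).ne_iff_eventually_ne
          ((e j).continuousAt_symm (hy₀ j))).1 <| by rwa [hσ, hσ, Subtype.coe_ne_coe]
    exact hne.mono fun y hy i j => not_imp_not.1 (hy i j)
  have hsection : ∀ᶠ y in 𝓝 y₀, ∀ i : ↥(K ∩ t ⁻¹' {y₀}), t ((e i).symm y) = y :=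
    eventually_all.2 fun i => ((e i).open_target.eventually_mem (hy₀ i)).mono fun y hy =>
      (congrFun (hte i) _).trans ((e i).right_inv hy)
  have hrange : ∀ᶠ y in 𝓝 y₀, ∀ x : K, t x = y →
      (x : X) ∈ range fun i : ↥(K ∩ t ⁻¹' {y₀}) => (e i).symm (t x) := by
    have := isCompact_iff_compactSpace.1 hK
    refine (htc.comp continuous_subtype_val).isClosedMap.eventually_nhds_fiber y₀ fun x₀ hx₀ => ?_
    filter_upwards [continuous_subtype_val.continuousAt ((e x₀).open_source.mem_nhds (he x₀))]
      with x hx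
    exact ⟨⟨x₀, x₀.2, hx₀⟩, (congrArg _ (congrFun (hte x₀) x)).trans ((e x₀).left_inv hx)⟩
  filter_upwards [hinj, hsection, hrange] with y hy_inj hy_section hy_range
  refine ⟨hy_inj, hy_section, ?_⟩
  rintro x ⟨hx, rfl⟩
  exact hy_range ⟨x, hx⟩ rfl

theorem continuous_finsum_fibre [T2Space X] [T2Space Y] [AddCommMonoid M] [TopologicalSpace M]
    [ContinuousAdd M] (ht : IsLocalHomeomorph t) {F : X → M} (hF : Continuous F)
    (hsupp : IsRelativelyCompactOver t (support F)) :
    Continuous fun y => ∑ᶠ x ∈ t ⁻¹' {y}, F x := by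
  refine continuous_iff_continuousAt.2 fun y₀ => ?_
  obtain ⟨K, hK, hFK⟩ := hsupp y₀
  obtain ⟨σ, hσ, hσK⟩ := exists_local_sections_of_isCompact ht hK y₀
  have := (finite_inter_fibre_of_isCompact ht hK y₀).fintype
  have hsum : (fun y => ∑ᶠ x ∈ t ⁻¹' {y}, F x) =ᶠ[𝓝 y₀] fun y => ∑ i, F (σ i y) := by
    filter_upwards [hFK, hσK] with y hFy ⟨hinj, hsection, hrange⟩
    rw [← finsum_eq_sum_of_fintype, ← finsum_mem_range (f := F) hinj]
    refine finsum_mem_inter_support_eq' F _ _ fun x hx =>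
      ⟨fun hxy => hrange ⟨hFy ⟨hx, hxy⟩, hxy⟩, ?_⟩
    rintro ⟨i, rfl⟩
    exact hsection i
  exact ContinuousAt.congr (tendsto_finsetSum _ fun i _ => hF.continuousAt.comp (hσ i)) hsum.symm

end RelativelyCompactOver

theorem exists_continuous_eq_of_finite {X ι : Type*} [TopologicalSpace X] [T2Space X]
    [LocallyCompactSpace X] [Finite ι] {U : Set X} (hU : IsOpen U) {p : ι → X} (hp : Injective p)
    (hpU : ∀ i, p i ∈ U) (c : ι → ℂ) :
    ∃ F : X → ℂ, Continuous F ∧ (∀ x ∉ U, F x = 0) ∧ ∀ i, F (p i) = c i := by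
  classical
  have := Fintype.ofFinite ι
  have hbump (i : ι) : ∃ f : C(X, ℝ), (∀ x ∉ U, f x = 0) ∧
      ∀ j, f (p j) = if i = j then 1 else 0 := by
    have hdisj : Disjoint {p i} (Uᶜ ∪ p '' {i}ᶜ) := by
      simp [hpU, hp.eq_iff]
    obtain ⟨f, hf₀, hf₁, -⟩ := exists_continuous_zero_one_of_isCompact' isCompact_singleton
      (hU.isClosed_compl.union ((toFinite {i}ᶜ).image p).isClosed) hdisj
    refine ⟨f, fun x hx => hf₀ (Or.inl hx), fun j => ?_⟩
    split_ifs with hij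
    · exact hf₁ (hij ▸ rfl)
    · exact hf₀ (Or.inr ⟨j, Ne.symm hij, rfl⟩)
  choose f hf₀ hf using hbump
  refine ⟨fun x => ∑ i, c i * (f i x : ℂ), by fun_prop, fun x hx => ?_, fun j => ?_⟩
  · simp only [hf₀ _ x hx, Complex.ofReal_zero, mul_zero, Finset.sum_const_zero]
  · simp only [hf, apply_ite Complex.ofReal, Complex.ofReal_one, Complex.ofReal_zero, mul_ite,
      mul_one, mul_zero, Finset.sum_ite_eq', Finset.mem_univ, if_true]

section FibreL2

universe u₁ u₂

variable {X : Type u₁} {B : Type u₂} {t : X → B} {A : Set X}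

/-- The part of the fibre of `t` over `b` that lies in `A`. -/
abbrev FibreIn (t : X → B) (A : Set X) (b : B) : Type u₁ :=
  {x // x ∈ A ∧ t x = b}

/-- The Hilbert space of functions on the (finite) part of the fibre of `t` over `b` that lies in
`A`, the fibre over `b` of `fibreL2Family`. -/
abbrev FibreL2 (t : X → B) (A : Set X) (b : B) : Type u₁ :=
  EuclideanSpace ℂ (FibreIn t A b)

/-- The function on `X` that a section of the spaces `FibreL2 t A b` amounts to, extended by zero
outside `A`. Continuity of this extension singles out the sections of `fibreL2Family`. -/
noncomputable def extendZero : (∀ b, FibreL2 t A b) →ₗ[ℂ] X → ℂ where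
  toFun s x := open Classical in if h : x ∈ A then s (t x) ⟨x, h, rfl⟩ else 0
  map_add' s s' := by
    ext x
    by_cases h : x ∈ A <;> simp [h]
  map_smul' c s := by
    ext x
    by_cases h : x ∈ A <;> simp [h]

/-- The section of the spaces `FibreL2 t A b` given by the restrictions of a function on `X`. -/
def restrictFibres (t : X → B) (A : Set X) (F : X → ℂ) (b : B) : FibreL2 t A b :=
  WithLp.toLp 2 fun i => F i

theorem extendZero_apply_coe (s : ∀ b, FibreL2 t A b) {b : B} (i : FibreIn t A b) :
    extendZero s i = s b i := by
  obtain ⟨x, hx, rfl⟩ := i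
  exact dif_pos hx

theorem extendZero_of_notMem (s : ∀ b, FibreL2 t A b) {x : X} (hx : x ∉ A) :
    extendZero s x = 0 :=
  dif_neg hx

theorem extendZero_restrictFibres {F : X → ℂ} (hF : ∀ x ∉ A, F x = 0) :
    extendZero (restrictFibres t A F) = F := by
  ext x
  by_cases hx : x ∈ A
  · exact extendZero_apply_coe _ ⟨x, hx, rfl⟩
  · rw [extendZero_of_notMem _ hx, hF x hx]

theorem sum_fibreIn_eq_finsum {M : Type*} [AddCommMonoid M] {b : B} [Fintype (FibreIn t A b)]
    {F : X → M} (hF : ∀ x ∉ A, F x = 0) :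
    ∑ i : FibreIn t A b, F i = ∑ᶠ x ∈ t ⁻¹' {b}, F x := by
  rw [← finsum_eq_sum_of_fintype, ← finsum_mem_range (f := F) Subtype.val_injective,
    Subtype.range_coe_subtype]
  exact finsum_mem_inter_support_eq' F _ _ fun x hx =>
    ⟨And.right, fun hxb => ⟨not_imp_comm.1 (hF x) hx, hxb⟩⟩

theorem norm_extendZero_sub_le [∀ b, Fintype (FibreIn t A b)]
    (s s' : ∀ b, FibreL2 t A b) (x : X) :
    ‖extendZero s x - extendZero s' x‖ ≤ ‖s (t x) - s' (t x)‖ := by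
  by_cases hx : x ∈ A
  · rw [extendZero_apply_coe s ⟨x, hx, rfl⟩, extendZero_apply_coe s' ⟨x, hx, rfl⟩]
    exact PiLp.norm_apply_le (s (t x) - s' (t x)) ⟨x, hx, rfl⟩
  · rw [extendZero_of_notMem s hx, extendZero_of_notMem s' hx, sub_zero, norm_zero]
    exact norm_nonneg _

variable [TopologicalSpace X] [TopologicalSpace B] [∀ b, Fintype (FibreIn t A b)]

theorem continuous_inner_of_extendZero [T2Space X] [T2Space B] (ht : IsLocalHomeomorph t)
    (hA : IsRelativelyCompactOver t A) {s s' : ∀ b, FibreL2 t A b}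
    (hs : Continuous (extendZero s)) (hs' : Continuous (extendZero s')) :
    Continuous fun b => inner ℂ (s b) (s' b) := by
  have h₀ : ∀ x ∉ A, inner ℂ (extendZero s x) (extendZero s' x) = 0 := fun x hx => by
    rw [extendZero_of_notMem s hx, inner_zero_left]
  have hsum : (fun b => inner ℂ (s b) (s' b)) =
      fun b => ∑ᶠ x ∈ t ⁻¹' {b}, inner ℂ (extendZero s x) (extendZero s' x) := by
    ext b
    rw [← sum_fibreIn_eq_finsum h₀, PiLp.inner_apply]
    simp only [extendZero_apply_coe]
  exact hsum ▸ continuous_finsum_fibre ht (hs.inner hs')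
    (hA.mono fun x hx => not_imp_comm.1 (h₀ x) hx)

/-- The direct image along a local homeomorphism `t : X → B` of the trivial line bundle on an open
set `A` whose fibres over `B` are finite. -/
noncomputable def fibreL2Family [T2Space X] [LocallyCompactSpace X] [T2Space B]
    [LocallyCompactSpace B] (ht : IsLocalHomeomorph t) (hA : IsOpen A)
    (hAc : IsRelativelyCompactOver t A) : HilbertFamily.{u₂, u₁} B where
  fibre := FibreL2 t A
  sections := (continuousSubmodule X ℂ ℂ).comap extendZero
  exists_section b e := by
    obtain ⟨F, hF, hFA, hFe⟩ := exists_continuous_eq_of_finite hA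
      (Subtype.val_injective (p := fun x => x ∈ A ∧ t x = b)) (fun i => i.2.1) e
    exact ⟨restrictFibres t A F,
      show Continuous (extendZero _) by rwa [extendZero_restrictFibres hFA], PiLp.ext hFe⟩
  continuous_inner _ hs _ hs' := continuous_inner_of_extendZero ht hAc hs hs'
  mem_of_locally_approx e he := by
    refine continuous_of_locally_uniform_approx_of_continuousAt fun x u hu => ?_
    obtain ⟨ε, hε, hεu⟩ := Metric.mem_uniformity_dist.1 hu
    obtain ⟨U, hU, s, hs, hUs⟩ := he (t x) ε hε
    refine ⟨_, ht.continuous.continuousAt hU, extendZero s, Continuous.continuousAt hs,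
      fun k hk => hεu ?_⟩
    rw [dist_comm, dist_eq_norm]
    exact (norm_extendZero_sub_le s e k).trans_lt (hUs _ hk)

end FibreL2

section OrbitSpace

variable {G₀ : Type u} [Groupoid.{v} G₀]

variable (G₀) in
/-- The orbit space of a groupoid, with the quotient topology. -/
abbrev OrbitSpace : Type u :=
  Quotient (isIsomorphicSetoid G₀)

/-- The orbit of an object, as a point of the orbit space. -/
abbrev orbit (x : G₀) : OrbitSpace G₀ :=
  Quotient.mk _ x

theorem orbit_eq_orbit_iff {x y : G₀} : orbit x = orbit y ↔ Nonempty (x ⟶ y) :=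
  Quotient.eq.trans (Groupoid.isoEquivHom x y).nonempty_congr

variable [TopologicalSpace G₀] [TopologicalSpace (ArrowSpace G₀)]

theorem isOpenQuotientMap_orbit (hs : Continuous (ArrowSpace.src : ArrowSpace G₀ → G₀))
    (ht : IsOpenMap (ArrowSpace.tgt : ArrowSpace G₀ → G₀)) :
    IsOpenQuotientMap (orbit : G₀ → OrbitSpace G₀) := by
  refine ⟨Quotient.mk_surjective, continuous_quotient_mk', fun V hV => ?_⟩
  have hsaturation : orbit ⁻¹' (orbit '' V) = ArrowSpace.tgt '' (ArrowSpace.src ⁻¹' V) := by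
    ext y
    constructor
    · rintro ⟨x, hx, hxy⟩
      obtain ⟨f⟩ := orbit_eq_orbit_iff.1 hxy
      exact ⟨⟨x, y, f⟩, hx, rfl⟩
    · rintro ⟨⟨x, y, f⟩, hx, rfl⟩
      exact ⟨x, hx, orbit_eq_orbit_iff.2 ⟨f⟩⟩
  rw [← isQuotientMap_quotient_mk'.isOpen_preimage]
  exact hsaturation ▸ ht _ (hV.preimage hs)

theorem t2Space_orbitSpace (hs : Continuous (ArrowSpace.src : ArrowSpace G₀ → G₀))
    (ht : IsOpenMap (ArrowSpace.tgt : ArrowSpace G₀ → G₀))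
    (hp : IsClosedMap fun g : ArrowSpace G₀ => (g.src, g.tgt)) : T2Space (OrbitSpace G₀) := by
  have hrange : {q : G₀ × G₀ | orbit q.1 = orbit q.2} =
      range fun g : ArrowSpace G₀ => (g.src, g.tgt) := by
    ext ⟨x, y⟩
    refine orbit_eq_orbit_iff.trans ⟨fun ⟨f⟩ => ⟨⟨x, y, f⟩, rfl⟩, ?_⟩
    rintro ⟨⟨x, y, f⟩, ⟨⟩⟩
    exact ⟨f⟩
  rw [t2Space_iff_of_isOpenQuotientMap (isOpenQuotientMap_orbit hs ht), hrange]
  exact hp.isClosed_range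

theorem paracompactSpace_orbitSpace [LocallyCompactSpace G₀] [SigmaCompactSpace G₀]
    (hs : Continuous (ArrowSpace.src : ArrowSpace G₀ → G₀))
    (ht : IsOpenMap (ArrowSpace.tgt : ArrowSpace G₀ → G₀))
    (hp : IsClosedMap fun g : ArrowSpace G₀ => (g.src, g.tgt)) :
    ParacompactSpace (OrbitSpace G₀) := by
  have hπ := isOpenQuotientMap_orbit hs ht
  have := t2Space_orbitSpace hs ht hp
  have := hπ.locallyCompactSpace
  have : SigmaCompactSpace (OrbitSpace G₀) :=
    isSigmaCompact_univ_iff.1 (hπ.surjective.range_eq ▸ isSigmaCompact_range hπ.continuous)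
  infer_instance

theorem isRelativelyCompactOver_tgt [LocallyCompactSpace G₀]
    (hp : IsProperMap fun g : ArrowSpace G₀ => (g.src, g.tgt)) {W : Set G₀}
    (hW : IsRelativelyCompactOver (orbit : G₀ → OrbitSpace G₀) W) :
    IsRelativelyCompactOver (ArrowSpace.tgt : ArrowSpace G₀ → G₀) (ArrowSpace.src ⁻¹' W) :=
  fun x => by
  obtain ⟨L, hL, hWL⟩ := hW (orbit x)
  obtain ⟨C, hC, hxC⟩ := exists_compact_mem_nhds x
  refine ⟨_, hp.isCompact_preimage (hL.prod hC), ?_⟩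
  filter_upwards [continuous_quotient_mk'.continuousAt.eventually hWL, hxC] with y hyL hyC
  rintro g ⟨hg, rfl⟩
  exact ⟨hyL ⟨hg, orbit_eq_orbit_iff.2 ⟨g.hom⟩⟩, hyC⟩

end OrbitSpace

theorem locallyCompactSpace_of_isProperMap {X Y : Type*} [TopologicalSpace X] [R1Space X]
    [TopologicalSpace Y] [WeaklyLocallyCompactSpace Y] {f : X → Y} (hf : IsProperMap f) :
    LocallyCompactSpace X := by
  have : WeaklyLocallyCompactSpace X := ⟨fun x => by
    obtain ⟨K, hK, hxK⟩ := exists_compact_mem_nhds (f x)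
    exact ⟨f ⁻¹' K, hf.isCompact_preimage hK, hf.continuous.continuousAt hxK⟩⟩
  infer_instance

section Translation

variable {G₀ : Type u} [Groupoid.{v} G₀] {W : Set G₀} {x y z : G₀}

/-- The arrows into `x` with source in `W`. -/
abbrev ArrowsInto (W : Set G₀) (x : G₀) : Type (max u v) :=
  FibreIn (ArrowSpace.tgt : ArrowSpace G₀ → G₀) (ArrowSpace.src ⁻¹' W) x

/-- The Hilbert space of functions on the (finite) set of arrows into `x` with source in `W`. -/
abbrev ArrowsL2 (W : Set G₀) (x : G₀) : Type (max u v) :=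
  FibreL2 (ArrowSpace.tgt : ArrowSpace G₀ → G₀) (ArrowSpace.src ⁻¹' W) x

/-- Composition with `g : x ⟶ y`, as a map from the arrows into `x` to the arrows into `y`. -/
def postcomp (g : x ⟶ y) : ArrowsInto W x → ArrowsInto W y :=
  fun i => ⟨⟨i.1.src, y, i.1.hom ≫ eqToHom i.2.2 ≫ g⟩, i.2.1, rfl⟩

theorem postcomp_id (i : ArrowsInto W x) : postcomp (𝟙 x) i = i := by
  obtain ⟨⟨a, x, k⟩, ha, rfl⟩ := i
  simp only [postcomp, eqToHom_refl, Category.comp_id]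

theorem postcomp_comp (f : x ⟶ y) (g : y ⟶ z) (i : ArrowsInto W x) :
    postcomp (f ≫ g) i = postcomp g (postcomp f i) := by
  simp [postcomp]

theorem postcomp_left_injective (i : ArrowsInto W x) :
    Injective fun g : x ⟶ y => postcomp g i := by
  intro g g' h
  have hcomp : i.1.hom ≫ eqToHom i.2.2 ≫ g = i.1.hom ≫ eqToHom i.2.2 ≫ g' := by
    injection congrArg Subtype.val h
  simpa only [cancel_epi] using hcomp

/-- Composition with `g : x ⟶ y`, as a bijection. -/
def postcompEquiv (g : x ⟶ y) : ArrowsInto W x ≃ ArrowsInto W y where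
  toFun := postcomp g
  invFun := postcomp (Groupoid.inv g)
  left_inv i := by rw [← postcomp_comp, Groupoid.comp_inv, postcomp_id]
  right_inv i := by rw [← postcomp_comp, Groupoid.inv_comp, postcomp_id]

variable [∀ x, Fintype (ArrowsInto W x)]

/-- Translation of functions on arrows along `g`; it takes `v` to the function with value `v k` at
`k ≫ g`. -/
noncomputable def translateArrows (g : x ⟶ y) : ArrowsL2 W x ≃ₗᵢ[ℂ] ArrowsL2 W y :=
  LinearIsometryEquiv.piLpCongrLeft 2 ℂ ℂ (postcompEquiv g)

theorem translateArrows_eq_iff {g : x ⟶ y} {v : ArrowsL2 W x} {w : ArrowsL2 W y} :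
    translateArrows g v = w ↔ ∀ i, v i = w (postcomp g i) := by
  rw [translateArrows, ← LinearIsometryEquiv.eq_symm_apply, LinearIsometryEquiv.piLpCongrLeft_symm]
  exact ⟨fun h i => congrArg (· i) h, fun h => PiLp.ext h⟩

theorem translateArrows_apply_postcomp (g : x ⟶ y) (v : ArrowsL2 W x) (i : ArrowsInto W x) :
    translateArrows g v (postcomp g i) = v i :=
  (translateArrows_eq_iff.1 rfl i).symm

theorem translateArrows_id (v : ArrowsL2 W x) : translateArrows (𝟙 x) v = v :=
  translateArrows_eq_iff.2 fun i => by rw [postcomp_id]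

theorem translateArrows_comp (f : x ⟶ y) (g : y ⟶ z) (v : ArrowsL2 W x) :
    translateArrows (f ≫ g) v = translateArrows g (translateArrows f v) :=
  translateArrows_eq_iff.2 fun i => by
    rw [postcomp_comp, translateArrows_apply_postcomp, translateArrows_apply_postcomp]

theorem translateArrows_left_injective (i : ArrowsInto W x) :
    Injective fun g : x ⟶ y => translateArrows (W := W) g := by
  classical
  intro g g' h
  have hsingle : EuclideanSpace.single (postcompEquiv g i) (1 : ℂ) =
      EuclideanSpace.single (postcompEquiv g' i) 1 := by
    simpa only [translateArrows, EuclideanSpace.piLpCongrLeft_single] using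
      congrArg (· (EuclideanSpace.single i 1)) h
  refine postcomp_left_injective i (by_contra fun hne => one_ne_zero (α := ℂ) ?_)
  simpa [show postcompEquiv g i ≠ postcompEquiv g' i from hne] using
    congrArg (· (postcompEquiv g i)) hsingle

end Translation

section Continuity

variable {G₀ : Type u} [Groupoid.{v} G₀] [TopologicalSpace G₀] [TopologicalSpace (ArrowSpace G₀)]

theorem HilbertFamily.isOpen_tube {B : Type u} [TopologicalSpace B] [LocallyCompactSpace B]
    [T2Space B] (E : HilbertFamily.{u, w} B) {V : Set B} (hV : IsOpen V) {s : ∀ x, E.fibre x}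
    (hs : s ∈ E.sections) {ε : ℝ} (hε : 0 < ε) : IsOpen (E.tube V s ε) :=
  TopologicalSpace.isOpen_generateFrom_of_mem ⟨V, hV, s, hs, ε, hε, rfl⟩

theorem HilbertFamily.continuous_action_of_forall_section [LocallyCompactSpace G₀] [T2Space G₀]
    {E : HilbertFamily.{u, w} G₀} (act : ∀ {x y : G₀}, (x ⟶ y) → (E.fibre x →ₗᵢ[ℂ] E.fibre y))
    (ht : Continuous (ArrowSpace.tgt : ArrowSpace G₀ → G₀))
    (hact : ∀ s ∈ E.sections, ∀ g₀ : ArrowSpace G₀, ∃ s' ∈ E.sections,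
      ∀ᶠ g in 𝓝 g₀, act g.hom (s' g.src) = s g.tgt) :
    Continuous fun p : ActionDomain E => (⟨p.arrow.tgt, act p.arrow.hom p.vec⟩ : E.Total) := by
  have htoProd : Continuous (ActionDomain.toProd : ActionDomain E → _) := continuous_induced_dom
  have harrow : Continuous (ActionDomain.arrow : ActionDomain E → _) :=
    continuous_fst.comp htoProd
  refine continuous_generateFrom_iff.2 ?_
  rintro _ ⟨V, hV, s, hs, ε, hε, rfl⟩
  refine isOpen_iff_eventually.2 fun p₀ hp₀ => ?_
  obtain ⟨s', hs', hss'⟩ := hact s hs p₀.arrow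
  have hnorm {g : ArrowSpace G₀} (hg : act g.hom (s' g.src) = s g.tgt) (v : E.fibre g.src) :
      ‖s g.tgt - act g.hom v‖ = ‖s' g.src - v‖ := by
    rw [← hg, ← map_sub, LinearIsometry.norm_map]
  have htube : ∀ᶠ p in 𝓝 p₀, p.toProd.2 ∈ E.tube univ s' ε :=
    (continuous_snd.comp htoProd).continuousAt.eventually_mem <|
      (E.isOpen_tube isOpen_univ hs' hε).mem_nhds
        ⟨mem_univ _, (hnorm hss'.self_of_nhds p₀.vec).symm.trans_lt hp₀.2⟩
  filter_upwards [harrow.continuousAt.eventually hss', htube,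
    (ht.comp harrow).continuousAt.eventually_mem (hV.mem_nhds hp₀.1)] with p hp hp' hpV
  exact ⟨hpV, (hnorm hp p.vec).trans_lt hp'.2⟩

theorem exists_local_bisection (hs : IsLocalHomeomorph (ArrowSpace.src : ArrowSpace G₀ → G₀))
    (g₀ : ArrowSpace G₀) :
    ∃ (D : Set G₀) (Y : G₀ → G₀) (H : ∀ x, x ⟶ Y x), IsOpen D ∧ g₀.src ∈ D ∧
      ContinuousOn (fun x => (⟨x, Y x, H x⟩ : ArrowSpace G₀)) D ∧
        ∀ᶠ g in 𝓝 g₀, g = ⟨g.src, Y g.src, H g.src⟩ := by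
  obtain ⟨e, he, hse⟩ := hs g₀
  have harrow (x : G₀) : ∃ (y : G₀) (f : x ⟶ y), x ∈ e.target → ⟨x, y, f⟩ = e.symm x := by
    by_cases hx : x ∈ e.target
    · have hsrc : (e.symm x).src = x := (congrFun hse _).trans (e.right_inv hx)
      generalize e.symm x = k at hsrc
      obtain rfl := hsrc
      exact ⟨k.tgt, k.hom, fun _ => rfl⟩
    · exact ⟨x, 𝟙 x, fun h => absurd h hx⟩
  choose Y H hYH using harrow
  have hmem {g : ArrowSpace G₀} (hg : g ∈ e.source) : g.src ∈ e.target :=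
    hse ▸ e.map_source hg
  refine ⟨e.target, Y, H, e.open_target, hmem he, e.continuousOn_symm.congr hYH, ?_⟩
  filter_upwards [e.open_source.mem_nhds he] with g hg
  rw [hYH _ (hmem hg), hse, e.left_inv hg]

end Continuity

section TranslationRep

variable {G₀ : Type u} [Groupoid.{v} G₀] [TopologicalSpace G₀] [TopologicalSpace (ArrowSpace G₀)]
  [LocallyCompactSpace G₀] [T2Space G₀] {W : Set G₀} [∀ x, Fintype (ArrowsInto W x)]

theorem exists_translateArrows_eq (hs : IsLocalHomeomorph (ArrowSpace.src : ArrowSpace G₀ → G₀))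
    (ht : Continuous (ArrowSpace.tgt : ArrowSpace G₀ → G₀))
    (hmul : Continuous (ComposablePair.mul : ComposablePair G₀ → ArrowSpace G₀))
    {s : ∀ x, ArrowsL2 W x} (h : Continuous (extendZero s)) (g₀ : ArrowSpace G₀) :
    ∃ s' : ∀ x, ArrowsL2 W x, Continuous (extendZero s') ∧
      ∀ᶠ g in 𝓝 g₀, translateArrows g.hom (s' g.src) = s g.tgt := by
  obtain ⟨D, Y, H, hD, hg₀D, hYH, hgH⟩ := exists_local_bisection hs g₀
  obtain ⟨K, hK, hKD, hKc⟩ := local_compact_nhds (hD.mem_nhds hg₀D)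
  obtain ⟨φ, hφ, -, hφD, -⟩ := exists_continuousMap_one_of_isCompact_subset_isOpen hKc hD hKD
  -- Translate `s` back along the bisection through `g₀`; as it is defined only over `D`, cut off
  -- by `φ`.
  let q (k : ArrowSpace G₀) : ComposablePair G₀ := ⟨k.src, k.tgt, Y k.tgt, H k.tgt, k.hom⟩
  let F (k : ArrowSpace G₀) : ℂ := (φ k.tgt : ℂ) * extendZero s (q k).mul
  have hq : ContinuousOn q (ArrowSpace.tgt ⁻¹' D) :=
    (Topology.IsInducing.mk rfl).continuousOn_iff.2 <|
      (hYH.comp ht.continuousOn fun _ hk => hk).prodMk continuousOn_id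
  have hF : Continuous F := by
    refine ContinuousOn.continuous_of_tsupport_subset
      (.mul (by fun_prop) ((h.comp hmul).comp_continuousOn hq)) (hD.preimage ht) <|
      (closure_minimal (fun k hk => ?_) ((isClosed_tsupport φ).preimage ht)).trans
        (preimage_mono hφD)
    exact subset_tsupport φ fun hφk => hk (by simp only [F, hφk, Complex.ofReal_zero, zero_mul])
  have hF₀ : ∀ k ∉ ArrowSpace.src ⁻¹' W, F k = 0 := fun k hk => by
    simp only [F, extendZero_of_notMem s (x := (q k).mul) hk, mul_zero]
  refine ⟨restrictFibres _ _ F, by rwa [extendZero_restrictFibres hF₀], ?_⟩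
  filter_upwards [hgH, hs.continuous.continuousAt.eventually_mem hK]
  rintro ⟨x, y, f⟩ hf hx
  obtain rfl : y = Y x := congrArg ArrowSpace.tgt hf
  obtain rfl : f = H x := by injection hf
  refine translateArrows_eq_iff.2 fun ⟨k, hk, hkx⟩ => ?_
  obtain rfl : k.tgt = x := hkx
  calc F k = extendZero s (q k).mul := by
        simp only [F, hφ hx, Pi.one_apply, Complex.ofReal_one, one_mul]
    _ = extendZero s (postcomp (H k.tgt) ⟨k, hk, rfl⟩ : ArrowsInto W _) := by
        simp only [q, ComposablePair.mul, postcomp, eqToHom_refl, Category.id_comp]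
    _ = s (Y k.tgt) (postcomp (H k.tgt) ⟨k, hk, rfl⟩) := extendZero_apply_coe s _

/-- The representation by translation of functions on the arrows with source in `W`. -/
noncomputable def translationRep [T2Space (ArrowSpace G₀)] [LocallyCompactSpace (ArrowSpace G₀)]
    (hs : IsLocalHomeomorph (ArrowSpace.src : ArrowSpace G₀ → G₀))
    (ht : IsLocalHomeomorph (ArrowSpace.tgt : ArrowSpace G₀ → G₀))
    (hmul : Continuous (ComposablePair.mul : ComposablePair G₀ → ArrowSpace G₀))
    (hW : IsOpen W)
    (hWt : IsRelativelyCompactOver (ArrowSpace.tgt : ArrowSpace G₀ → G₀) (ArrowSpace.src ⁻¹' W)) :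
    GroupoidRep (fibreL2Family ht (hW.preimage hs.continuous) hWt) where
  act g := (translateArrows g).toLinearEquiv
  act_id _ := translateArrows_id
  act_comp := translateArrows_comp
  continuous_act := HilbertFamily.continuous_action_of_forall_section
    (E := fibreL2Family ht (hW.preimage hs.continuous) hWt)
    (fun g => (translateArrows g).toLinearIsometry) ht.continuous
    fun _ h => exists_translateArrows_eq hs ht.continuous hmul h

variable [T2Space (ArrowSpace G₀)] [LocallyCompactSpace (ArrowSpace G₀)]
  {hs : IsLocalHomeomorph (ArrowSpace.src : ArrowSpace G₀ → G₀)}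
  {ht : IsLocalHomeomorph (ArrowSpace.tgt : ArrowSpace G₀ → G₀)}
  {hmul : Continuous (ComposablePair.mul : ComposablePair G₀ → ArrowSpace G₀)} {hW : IsOpen W}
  {hWt : IsRelativelyCompactOver (ArrowSpace.tgt : ArrowSpace G₀ → G₀) (ArrowSpace.src ⁻¹' W)}

theorem translationRep_isUnitary : (translationRep hs ht hmul hW hWt).IsUnitary :=
  fun g e e' => LinearIsometryEquiv.inner_map_map (translateArrows (W := W) g) e e'

theorem translationRep_isFaithful (h : ∀ x, Nonempty (ArrowsInto W x)) :
    (translationRep hs ht hmul hW hWt).IsFaithful := fun x _ _ hgg' =>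
  translateArrows_left_injective (W := W) (h x).some <|
    LinearIsometryEquiv.toLinearEquiv_injective hgg'

end TranslationRep

theorem mainTheorem1_general (G₀ : Type u) [Groupoid.{v} G₀] [TopologicalSpace G₀]
    [LocallyCompactSpace G₀] [T2Space G₀] [ParacompactSpace (OrbitSpace G₀)]
    [TopologicalSpace (ArrowSpace G₀)] [T2Space (ArrowSpace G₀)]
    (hs : IsLocalHomeomorph (ArrowSpace.src : ArrowSpace G₀ → G₀))
    (ht : IsLocalHomeomorph (ArrowSpace.tgt : ArrowSpace G₀ → G₀))
    (hmul : Continuous (ComposablePair.mul : ComposablePair G₀ → ArrowSpace G₀))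
    (hp : IsProperMap fun g : ArrowSpace G₀ => (g.src, g.tgt)) :
    ∃ (E : HilbertFamily.{u, max u v} G₀) (ρ : GroupoidRep E),
      E.IsFiniteDimensional ∧ ρ.IsUnitary ∧ ρ.IsFaithful := by
  have := locallyCompactSpace_of_isProperMap hp
  obtain ⟨W, hW, hW_orbits, hWc⟩ := exists_isOpen_isRelativelyCompactOver
    (isOpenQuotientMap_orbit hs.continuous ht.isOpenMap)
  have hWt := isRelativelyCompactOver_tgt hp hWc
  have (x : G₀) : Fintype (ArrowsInto W x) := (hWt.finite_inter_fibre ht x).fintype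
  have hnonempty (x : G₀) : Nonempty (ArrowsInto W x) := by
    obtain ⟨a, ha, hax⟩ := hW_orbits.ge (mem_univ (orbit x))
    obtain ⟨k⟩ := orbit_eq_orbit_iff.1 hax
    exact ⟨⟨a, x, k⟩, ha, rfl⟩
  exact ⟨_, translationRep hs ht hmul hW hWt,
    fun x => inferInstanceAs (FiniteDimensional ℂ (ArrowsL2 W x)),
    translationRep_isUnitary, translationRep_isFaithful hnonempty⟩

theorem mainTheorem1 (n m : ℕ) (G₀ : Type u) [CategoryTheory.Groupoid.{v} G₀]
    [TopologicalSpace G₀] [LocallyCompactSpace G₀] [T2Space G₀]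
    [ChartedSpace (EuclideanSpace ℝ (Fin n)) G₀]
    [TopologicalSpace (ArrowSpace G₀)] [ChartedSpace (EuclideanSpace ℝ (Fin m)) (ArrowSpace G₀)]
    (hG : IsOrbifoldGroupoid n m G₀) :
    ∃ (E : HilbertFamily.{u, max u v} G₀) (ρ : GroupoidRep E),
      E.IsFiniteDimensional ∧ ρ.IsUnitary ∧ ρ.IsFaithful := by
  have := hG.secondCountable_obj
  have := hG.t2_arrow
  have := paracompactSpace_orbitSpace hG.continuous_src hG.isOpenMap_tgt hG.proper.isClosedMap
  exact mainTheorem1_general G₀ hG.etale_src.isLocalHomeomorph hG.etale_tgt.isLocalHomeomorph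
    hG.continuous_mul hG.proper
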